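/- Let $F$ be a field of characteristic zero, let $n$ be a natural number, and let $M_n(F)$ be the algebra of $n\times n$ matrices over $F$. Let $\Phi : M_n(F)\to M_n(F)$ be a multiplicative map, i.e. $\Phi(AB)=\Phi(A)\Phi(B)$ for all $A,B\in M_n(F)$, with $\Phi(0)=0$. Suppose that $\Phi$ is non-degenerate, i.e. there is a singular matrix $A\in M_n(F)$ with $\Phi(A)\neq 0$. Then there exist a (unital) ring homomorphism $\varphi:F\to F$ and an invertible matrix $R\in M_n(F)$ such that either $$\Phi(A)=R^{-1}\,(\varphi(a_{ij}))\,R\quad\text{for all } A=(a_{ij})\in M_n(F),$$ or $$\Phi(A)=R^{-1}\,\bigl((\varphi(a_{ij}))^{*}\bigr)^{t}\,R\quad\text{for all } A=(a_{ij})\in M_n(F).$$ Here $B^{*}$ denotes the adjugate of $B$ (the matrix with $BB^{*}=B^{*}B=\det(B)I_n$ whose entries are the polynomial cofactor expressions, $(B^*)_{ij}=(-1)^{i+j}\det B^{(j,i)}$, where $B^{(j,i)}$ is $B$ with row $j$ and column $i$ removed), and $B^t$ the transpose. The alternatives need not exclude each other. -/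

import Mathlib

/-- A map `Φ` on `n × n` matrices that is multiplicative is called non-degenerate if it does not
send every singular matrix to the zero matrix. -/
def IsNondegenerateMap {F : Type*} [Field F] {n : ℕ}
    (Φ : Matrix (Fin n) (Fin n) F →ₙ* Matrix (Fin n) (Fin n) F) : Prop :=
  ∃ A : Matrix (Fin n) (Fin n) F, A.det = 0 ∧ Φ A ≠ 0

/-! Let r be the least rank of a diagonal idempotent that Φ does not kill; non-degeneracy gives 1 ≤
r ≤ n - 1. Two distinct diagonal idempotents of rank r have a product of smaller rank, so their
images are C(n, r) nonzero orthogonal idempotents. Hence C(n, r) ≤ n, and r is 1 or n - 1. In both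
cases Φ produces n × n matrix units, which a conjugation makes standard. Compressing by them, each
entry of Φ(A) depends on one entry of A (r = 1) or on one submatrix of size n - 1 (r = n - 1), there
only through its determinant, by `monoidHom_factors_det`. The resulting multiplicative map F → F is
additive because transvections turn sums into products. -/

section MultiplicativeMatrixMaps

open Matrix

variable {F : Type*} [Field F]

/-! ### Idempotents, matrix units and multiplicative characters -/

/-- Pairwise orthogonal nonzero idempotent matrices are at most as many as the size. -/
theorem Matrix.card_le_of_orthogonal_idempotents {ι n : Type*} [Fintype ι] [Fintype n]
    (P : ι → Matrix n n F) (hne : ∀ i, P i ≠ 0)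
    (hid : ∀ i, P i * P i = P i) (horth : ∀ i j, i ≠ j → P i * P j = 0) :
    Fintype.card ι ≤ Fintype.card n := by
  classical
  have hv : ∀ i, ∃ v, P i *ᵥ v ≠ 0 := by
    intro i
    by_contra! h
    exact hne i (Matrix.ext_of_mulVec_single fun j => by rw [h, zero_mulVec])
  choose v hv using hv
  have hli : LinearIndependent F (fun i => P i *ᵥ v i) := by
    rw [Fintype.linearIndependent_iff]
    intro c hc i
    have h := congrArg (fun w => P i *ᵥ w) hc
    simp only [Matrix.mulVec_sum, Matrix.mulVec_smul, Matrix.mulVec_mulVec,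
      Matrix.mulVec_zero] at h
    rw [Finset.sum_eq_single i (fun j _ hj => by simp [horth i j hj.symm]) (by simp), hid] at h
    exact (smul_eq_zero.mp h).resolve_right (hv i)
  simpa using hli.fintype_card_le_finrank

/-- A system of `n × n` matrix units in `n × n` matrices is conjugate to the standard one. -/
theorem Matrix.exists_conj_matrixUnits {n : Type*} [Fintype n] [DecidableEq n]
    (G : n → n → Matrix n n F) (hmul : ∀ i j k, G i j * G j k = G i k)
    (horth : ∀ i j k l, j ≠ k → G i j * G k l = 0) (o : n) (ho : G o o ≠ 0) :
    ∃ Q : GL n F, ∀ i j, (↑Q⁻¹ : Matrix n n F) * G i j * (Q : Matrix n n F) = single i j 1 := by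
  obtain ⟨v, hv⟩ : ∃ v, G o o *ᵥ v ≠ 0 := by
    by_contra! h
    exact ho (Matrix.ext_of_mulVec_single fun j => by rw [h, zero_mulVec])
  let w : n → n → F := fun i => G i o *ᵥ v
  have hw : ∀ i j, G i j *ᵥ w j = w i := fun i j => by
    simp only [w, Matrix.mulVec_mulVec, hmul]
  have hw0 : ∀ i j k, j ≠ k → G i j *ᵥ w k = 0 := fun i j k h => by
    simp only [w, Matrix.mulVec_mulVec, horth _ _ _ _ h, Matrix.zero_mulVec]
  have hli : LinearIndependent F w := by
    rw [Fintype.linearIndependent_iff]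
    intro c hc i
    have h := congrArg (fun w => G o i *ᵥ w) hc
    simp only [Matrix.mulVec_sum, Matrix.mulVec_smul, Matrix.mulVec_zero] at h
    rw [Finset.sum_eq_single i (fun j _ hj => by simp [hw0 o i j hj.symm]) (by simp), hw] at h
    exact (smul_eq_zero.mp h).resolve_right hv
  have hu : IsUnit (Matrix.of w)ᵀ :=
    Matrix.linearIndependent_cols_iff_isUnit.mp hli
  obtain ⟨Q, hQ⟩ := hu
  refine ⟨Q, fun i j => ?_⟩
  have key : G i j * (Q : Matrix n n F) = (Q : Matrix n n F) * single i j 1 := by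
    rw [hQ]
    ext a b
    have hl : (G i j * (Matrix.of w)ᵀ) a b = (G i j *ᵥ w b) a := rfl
    rw [hl]
    by_cases hb : j = b
    · subst hb
      rw [hw, Matrix.mul_single_apply_same]
      simp
    · rw [hw0 i j b hb, Matrix.mul_single_apply_of_ne (hbj := Ne.symm hb)]
      rfl
  rw [mul_assoc, key, ← mul_assoc, Units.inv_mul, one_mul]

theorem Matrix.submatrix_perm_eq_mul {n : Type*} [Fintype n] [DecidableEq n] (A : Matrix n n F)
    (σ : Equiv.Perm n) :
    A.submatrix σ σ =
      (1 : Matrix n n F).submatrix σ id * A * (1 : Matrix n n F).submatrix id σ := by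
  ext a b
  simp [mul_apply, one_apply]

/-- A multiplicative character on square matrices over a field of characteristic zero factors
through the determinant. -/
theorem Matrix.monoidHom_factors_det [CharZero F] {m : Type*} [Fintype m] [DecidableEq m]
    [Nonempty m] (χ : Matrix m m F →* F) : ∃ ψ : F →* F, ∀ B, χ B = ψ B.det := by
  obtain ⟨o⟩ := ‹Nonempty m›
  let δ : m → F →* F := fun i =>
    { toFun := fun x => χ (diagonal (Pi.mulSingle i x))
      map_one' := by simp
      map_mul' := fun x y => by
        rw [← map_mul, diagonal_mul_diagonal, Pi.mulSingle_mul]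
        rfl }
  -- Swapping coordinates is a conjugation, invisible to a character with commutative values.
  have hδ : ∀ i, δ i = δ o := by
    intro i
    ext x
    let e := Equiv.swap o i
    have h1 : diagonal (Pi.mulSingle i x) = (diagonal (Pi.mulSingle o x)).submatrix e e := by
      rw [submatrix_diagonal_equiv]
      congr 1
      ext j
      have : e j = o ↔ j = i := by rw [Equiv.swap_apply_eq_iff, Equiv.swap_apply_left]
      simp [Pi.mulSingle_apply, this]
    have h2 : (1 : Matrix m m F).submatrix e id * (1 : Matrix m m F).submatrix id e = 1 := by
      ext a b
      simp [mul_apply, one_apply]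
    change χ _ = χ _
    rw [h1, submatrix_perm_eq_mul, map_mul, map_mul, mul_right_comm, ← map_mul, h2, map_one, one_mul]
  -- A transvection T is conjugate to T² by a diagonal matrix with entry 2, so χ(T) = χ(T)² with
  -- χ(T) ≠ 0.
  have htr : ∀ t : TransvectionStruct m F, χ t.toMatrix = 1 := by
    intro t
    have h2 : (2 : F) ≠ 0 := two_ne_zero
    let D : F → Matrix m m F := fun x => diagonal (Pi.mulSingle t.i x)
    have hne : χ t.toMatrix ≠ 0 := by
      intro h0
      have := congrArg χ t.inv_mul
      rw [map_mul, h0, mul_zero, map_one] at this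
      exact zero_ne_one this
    have hD : D 2 * D 2⁻¹ = 1 := by
      simp only [D]
      rw [diagonal_mul_diagonal, ← diagonal_one]
      congr 1
      ext a
      by_cases ha : a = t.i <;> simp [ha]
    have hc : D 2 * t.toMatrix * D 2⁻¹ = t.toMatrix * t.toMatrix := by
      obtain ⟨i, j, hij, c⟩ := t
      simp only [TransvectionStruct.toMatrix_mk, D]
      rw [transvection_mul_transvection_same _ _ hij]
      ext a b
      simp only [mul_diagonal, diagonal_mul, transvection, Matrix.add_apply, Matrix.one_apply,
        Matrix.single_apply, Pi.mulSingle_apply]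
      split_ifs <;> grind
    have h := congrArg χ hc
    rw [map_mul, map_mul, mul_right_comm, ← map_mul, hD, map_one, one_mul, map_mul] at h
    exact (mul_eq_left₀ hne).mp h.symm
  refine ⟨δ o, fun B => ?_⟩
  induction B using Matrix.diagonal_transvection_induction with
  | hdiag d =>
    have hprod : ∀ s : Finset m, χ (diagonal fun i => if i ∈ s then d i else 1) =
        ∏ i ∈ s, δ o (d i) := by
      intro s
      induction s using Finset.induction_on with
      | empty => simp
      | insert a s ha ih =>
        rw [Finset.prod_insert ha, ← ih, ← hδ a]
        change _ = χ _ * χ _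
        rw [← map_mul, diagonal_mul_diagonal]
        congr 2
        ext i
        by_cases hi : i = a
        · subst hi
          simp [ha]
        · simp [hi]
    simpa using hprod Finset.univ
  | htransvec t => rw [htr, TransvectionStruct.det, map_one]
  | hmul A B hA hB => rw [map_mul, hA, hB, det_mul, map_mul]

/-- Additivity of an entrywise map `ψ` which is compatible with multiplication after a
multiplicative substitution `Θ` reaching all transvections in one position. -/
theorem Matrix.map_add_of_entrywise {n : Type*} [Fintype n] [DecidableEq n]
    (Ψ Θ : Matrix n n F →ₙ* Matrix n n F) (ψ : F → F) (h0 : ψ 0 = 0) (h1 : ψ 1 = 1)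
    (h : ∀ A i j, Ψ A i j = ψ (Θ A i j)) {i j : n} (hij : i ≠ j)
    (hΘ : ∀ c, ∃ A, Θ A = transvection i j c) (c d : F) : ψ (c + d) = ψ c + ψ d := by
  obtain ⟨A, hA⟩ := hΘ c
  obtain ⟨B, hB⟩ := hΘ d
  have key : ∀ A c, Θ A = transvection i j c → Ψ A = transvection i j (ψ c) := by
    intro A c hA
    ext a b
    rw [h, hA]
    simp only [transvection, Matrix.add_apply, Matrix.one_apply, Matrix.single_apply]
    split_ifs <;> simp_all
  have hAB : Θ (A * B) = transvection i j (c + d) := by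
    rw [map_mul, hA, hB, transvection_mul_transvection_same _ _ hij]
  have h2 := key _ _ hAB
  rw [map_mul, key _ _ hA, key _ _ hB, transvection_mul_transvection_same _ _ hij] at h2
  have h3 := congrFun (congrFun h2 i) j
  simpa [transvection, hij] using h3.symm

/-! ### Diagonal idempotents and the least surviving rank -/

/-- The diagonal idempotent with support `S`. -/
def Matrix.diagIdem (F : Type*) [Field F] {n : Type*} [DecidableEq n] (S : Finset n) :
    Matrix n n F :=
  diagonal fun i => if i ∈ S then 1 else 0

theorem Matrix.diagIdem_mul {n : Type*} [Fintype n] [DecidableEq n] (S T : Finset n) :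
    diagIdem F S * diagIdem F T = diagIdem F (S ∩ T) := by
  simp only [diagIdem, diagonal_mul_diagonal]
  congr 1
  ext i
  by_cases hS : i ∈ S <;> by_cases hT : i ∈ T <;> simp [hS, hT]

/-- Diagonal idempotents of equal rank are conjugate by a permutation matrix. -/
theorem Matrix.map_diagIdem_eq_zero_of_card_eq {n : Type*} [Fintype n] [DecidableEq n]
    (Φ : Matrix n n F →ₙ* Matrix n n F) {S T : Finset n} (hST : S.card = T.card)
    (hS : Φ (diagIdem F S) = 0) : Φ (diagIdem F T) = 0 := by
  obtain ⟨σ, hσ⟩ : ∃ σ : Equiv.Perm n, ∀ x, σ x ∈ S ↔ x ∈ T := by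
    let e : {x // x ∈ T} ≃ {x // x ∈ S} := Finset.equivOfCardEq hST.symm
    exact ⟨e.extendSubtype, fun x => ⟨fun h => by
      by_contra hx
      exact e.extendSubtype_not_mem x hx h, e.extendSubtype_mem x⟩⟩
  have h : diagIdem F T = (diagIdem F S).submatrix σ σ := by
    rw [diagIdem, diagIdem, submatrix_diagonal_equiv]
    congr 1
    ext x
    simp [hσ]
  rw [h, submatrix_perm_eq_mul, map_mul, map_mul, hS, mul_zero, zero_mul]

theorem Nat.eq_one_or_eq_of_choose_le {m r : ℕ} (h1 : 1 ≤ r) (h2 : r ≤ m)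
    (h : (m + 1).choose r ≤ m + 1) : r = 1 ∨ r = m := by
  have key : ∀ n k : ℕ, 1 ≤ k → k + 1 ≤ n → n ≤ n.choose k := by
    intro n
    induction n with
    | zero => intros; omega
    | succ n ih =>
      intro k hk hkn
      obtain ⟨k, rfl⟩ : ∃ l, k = l + 1 := ⟨k - 1, by omega⟩
      rw [Nat.choose_succ_succ]
      rcases Nat.lt_or_ge (k + 1) n with hlt | hge
      · have := ih (k + 1) hk hlt
        have := Nat.choose_pos (n := n) (k := k) (by omega)
        rw [Nat.succ_eq_add_one]
        omega
      · obtain rfl : n = k + 1 := by omega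
        simp
  by_contra! hc
  obtain ⟨k, rfl⟩ : ∃ l, r = l + 1 := ⟨r - 1, by omega⟩
  -- By Pascal's rule the binomial is at least 2m, which exceeds m + 1 since here m ≥ 3.
  rw [Nat.choose_succ_succ, Nat.succ_eq_add_one] at h
  have := key m k (by omega) (by omega)
  have := key m (k + 1) (by omega) (by omega)
  omega

/-- The least rank of a diagonal idempotent not killed by `Φ` is `1` or the size minus one. -/
theorem Matrix.map_diagIdem_dichotomy {m : ℕ}
    (Φ : Matrix (Fin (m + 1)) (Fin (m + 1)) F →ₙ* Matrix (Fin (m + 1)) (Fin (m + 1)) F)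
    (hzero : Φ 0 = 0) {A : Matrix (Fin (m + 1)) (Fin (m + 1)) F} (hA : A.det = 0)
    (hΦA : Φ A ≠ 0) :
    ∃ r, 1 ≤ r ∧ r ≤ m ∧ (r = 1 ∨ r = m) ∧ (∀ S, S.card = r → Φ (diagIdem F S) ≠ 0) ∧
      ∀ S, S.card < r → Φ (diagIdem F S) = 0 := by
  classical
  have hex : ∃ S : Finset (Fin (m + 1)), S.card = m ∧ Φ (diagIdem F S) ≠ 0 := by
    obtain ⟨L, L', D, rfl⟩ := Pivot.exists_list_transvec_mul_diagonal_mul_list_transvec A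
    have hdet : ∏ i, D i = 0 := by
      simpa [det_mul, TransvectionStruct.det_toMatrix_prod] using hA
    obtain ⟨i, -, hi⟩ := Finset.prod_eq_zero_iff.mp hdet
    -- The diagonal part of A has a zero at i, so A factors through this corank-one idempotent.
    refine ⟨{i}ᶜ, by simp [Finset.card_compl], fun h0 => hΦA ?_⟩
    have hD : diagonal D = diagonal D * diagIdem F {i}ᶜ := by
      rw [diagIdem, diagonal_mul_diagonal]
      congr 1
      ext j
      by_cases hj : j = i <;> simp [hj, hi]
    rw [hD, map_mul, map_mul, map_mul, h0, mul_zero, mul_zero, zero_mul]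
  have hex' : ∃ r, ∃ S : Finset (Fin (m + 1)), S.card = r ∧ Φ (diagIdem F S) ≠ 0 := ⟨m, hex⟩
  let r := Nat.find hex'
  obtain ⟨S₀, hS₀, hΦS₀⟩ : ∃ S : Finset (Fin (m + 1)), S.card = r ∧ Φ (diagIdem F S) ≠ 0 :=
    Nat.find_spec hex'
  have hlt : ∀ S, S.card < r → Φ (diagIdem F S) = 0 := fun S hS => by
    by_contra hne
    exact Nat.find_min hex' hS ⟨S, rfl, hne⟩
  have hcard : ∀ S, S.card = r → Φ (diagIdem F S) ≠ 0 := fun S hS h0 =>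
    hΦS₀ (map_diagIdem_eq_zero_of_card_eq Φ (hS.trans hS₀.symm) h0)
  have hrm : r ≤ m := Nat.find_min' hex' hex
  have hr1 : 1 ≤ r := by
    by_contra! h
    have : S₀ = ∅ := by
      rw [← Finset.card_eq_zero]
      omega
    apply hΦS₀
    rw [this]
    simpa [diagIdem] using hzero
  refine ⟨r, hr1, hrm, Nat.eq_one_or_eq_of_choose_le hr1 hrm ?_, hcard, hlt⟩
  have := Matrix.card_le_of_orthogonal_idempotents
    (ι := {S : Finset (Fin (m + 1)) // S.card = r})
    (fun S => Φ (diagIdem F S.1)) (fun S => hcard _ S.2)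
    (fun S => by rw [← map_mul, diagIdem_mul, Finset.inter_self])
    (fun S T hST => by
      rw [← map_mul, diagIdem_mul]
      apply hlt
      refine (Finset.card_lt_card ⟨Finset.inter_subset_left, fun h => hST (Subtype.ext ?_)⟩).trans_eq S.2
      exact Finset.eq_of_subset_of_card_le (fun x hx => (Finset.mem_inter.mp (h hx)).2)
        (by rw [S.2, T.2]))
  simpa using this

/-- Conjugation by an invertible matrix, composed with a multiplicative map. -/
def Matrix.conjMap {n : Type*} [Fintype n] [DecidableEq n]
    (Φ : Matrix n n F →ₙ* Matrix n n F) (Q : GL n F) : Matrix n n F →ₙ* Matrix n n F where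
  toFun A := (↑Q⁻¹ : Matrix n n F) * Φ A * (Q : Matrix n n F)
  map_mul' A B := by
    rw [map_mul]
    simp only [mul_assoc, Units.mul_inv_cancel_left]

/-- Compressing by matrix units isolates one entry of A, so Ψ acts entrywise by a single function.
-/
theorem Matrix.exists_ringHom_of_map_single {n : Type*} [Fintype n] [DecidableEq n] [Nontrivial n]
    (Ψ : Matrix n n F →ₙ* Matrix n n F) (hzero : Ψ 0 = 0)
    (hΨ : ∀ i j, Ψ (single i j 1) = single i j 1) :
    ∃ φ : F →+* F, ∀ A, Ψ A = A.map φ := by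
  obtain ⟨o, p, hop⟩ := exists_pair_ne n
  let ψ : F → F := fun x => Ψ (single o o x) o o
  have hent : ∀ A i j, Ψ A i j = ψ (A i j) := by
    intro A i j
    have h : single o o (A i j) = single o i 1 * A * single j o 1 := by
      simp
    simp only [ψ]
    rw [h, map_mul, map_mul, hΨ, hΨ]
    simp
  have h0 : ψ 0 = 0 := by simp [ψ, hzero]
  have h1 : ψ 1 = 1 := by simp [ψ, hΨ]
  have hmul : ∀ x y, ψ (x * y) = ψ x * ψ y := by
    intro x y
    have h := congrFun (congrFun (map_mul Ψ (single o o x) (single o o y)) o) o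
    rw [single_mul_single_same, hent, mul_apply, Finset.sum_eq_single o] at h
    · simpa [hent] using h
    · intro b _ hb
      rw [hent, single_apply_of_col_ne _ _ hb.symm, h0, zero_mul]
    · simp
  have hadd := Matrix.map_add_of_entrywise Ψ (MulHom.id _) ψ h0 h1 hent hop (fun c => ⟨_, rfl⟩)
  exact ⟨{ toFun := ψ, map_one' := h1, map_mul' := hmul, map_zero' := h0, map_add' := hadd },
    fun A => by ext i j; exact hent A i j⟩

/-! ### The corank-one case -/

/-- Matrix units for the rank `m` matrices of size `m + 1`: `corankUnit i j` is a bijection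
from the standard basis without `j` onto the standard basis without `i`. -/
def Matrix.corankUnit (F : Type*) [Field F] {m : ℕ} (i j : Fin (m + 1)) :
    Matrix (Fin (m + 1)) (Fin (m + 1)) F :=
  (diagIdem F {0}ᶜ).submatrix i.cycleRange j.cycleRange

theorem Matrix.corankUnit_mul {m : ℕ} (i j k : Fin (m + 1)) :
    corankUnit F i j * corankUnit F j k = corankUnit F i k := by
  rw [corankUnit, corankUnit, submatrix_mul_equiv, diagIdem_mul, Finset.inter_self, corankUnit]

theorem Matrix.corankUnit_self {m : ℕ} (i : Fin (m + 1)) :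
    corankUnit F i i = diagIdem F {i}ᶜ := by
  rw [corankUnit, diagIdem, submatrix_diagonal_equiv, diagIdem]
  congr 1
  ext k
  have : i.cycleRange k = 0 ↔ k = i := by
    rw [← Fin.cycleRange_self i, i.cycleRange.injective.eq_iff]
  simp [this]

/-- Extension of a matrix by a zero row and a zero column. -/
def Matrix.zeroCons {m : ℕ} (B : Matrix (Fin m) (Fin m) F) :
    Matrix (Fin (m + 1)) (Fin (m + 1)) F :=
  of (Fin.cons 0 fun i => Fin.cons 0 (B i))

theorem Matrix.zeroCons_mul {m : ℕ} (A B : Matrix (Fin m) (Fin m) F) :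
    zeroCons (A * B) = zeroCons A * zeroCons B := by
  ext i j
  refine Fin.cases ?_ (fun i => ?_) i <;> refine Fin.cases ?_ (fun j => ?_) j <;>
    simp [zeroCons, mul_apply, Fin.sum_univ_succ]

theorem Matrix.zeroCons_one {m : ℕ} :
    zeroCons (1 : Matrix (Fin m) (Fin m) F) = diagIdem F {0}ᶜ := by
  ext i j
  refine Fin.cases ?_ (fun i => ?_) i <;> refine Fin.cases ?_ (fun j => ?_) j <;>
    simp [zeroCons, diagIdem, diagonal_apply, one_apply, (Fin.succ_ne_zero _).symm]

/-- Since `cycleRange` preserves the order of the remaining indices, the compression is the minor's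
submatrix with no reordering. -/
theorem Matrix.corankUnit_mul_mul_corankUnit {m : ℕ} (A : Matrix (Fin (m + 1)) (Fin (m + 1)) F)
    (i j : Fin (m + 1)) :
    corankUnit F 0 i * A * corankUnit F j 0 =
      zeroCons (A.submatrix i.succAbove j.succAbove) := by
  have hA : A = (A.submatrix i.cycleRange.symm j.cycleRange.symm).submatrix
      i.cycleRange j.cycleRange := by
    simp
  rw [hA, corankUnit, corankUnit, submatrix_mul_equiv, submatrix_mul_equiv]
  ext a b
  rw [diagIdem]
  refine Fin.cases ?_ (fun a => ?_) a <;> refine Fin.cases ?_ (fun b => ?_) b <;>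
    simp [zeroCons, diagonal_mul, mul_diagonal, Fin.cycleRange_symm_succ]

theorem Matrix.exists_ringHom_of_map_corankUnit [CharZero F] {m : ℕ} (hm : 1 ≤ m)
    (Ψ : Matrix (Fin (m + 1)) (Fin (m + 1)) F →ₙ* Matrix (Fin (m + 1)) (Fin (m + 1)) F)
    (hzero : Ψ 0 = 0) (hΨ : ∀ i j, Ψ (corankUnit F i j) = single i j 1) :
    ∃ (φ : F →+* F) (Q : GL (Fin (m + 1)) F),
      ∀ A, conjMap Ψ Q A = (A.map φ).adjugateᵀ := by
  have : Nonempty (Fin m) := ⟨⟨0, hm⟩⟩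
  have hcorner : ∀ B, Ψ (zeroCons B) = single 0 0 (Ψ (zeroCons B) 0 0) := by
    intro B
    have h : zeroCons B = corankUnit F 0 0 * zeroCons B * corankUnit F 0 0 := by
      rw [corankUnit_self, ← zeroCons_one, ← zeroCons_mul, ← zeroCons_mul, one_mul, mul_one]
    conv_lhs => rw [h, map_mul, map_mul, hΨ]
    simp
  let χ : Matrix (Fin m) (Fin m) F →* F :=
    { toFun := fun B => Ψ (zeroCons B) 0 0
      map_one' := by rw [zeroCons_one, ← corankUnit_self, hΨ]; simp
      map_mul' := fun A B => by
        rw [zeroCons_mul, map_mul, hcorner A, hcorner B]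
        simp }
  obtain ⟨ψ, hψ⟩ := Matrix.monoidHom_factors_det χ
  have hent : ∀ A i j, Ψ A i j = ψ ((-1) ^ (i + j : ℕ)) * ψ (A.adjugate j i) := by
    intro A i j
    have h := hψ (A.submatrix i.succAbove j.succAbove)
    change Ψ (zeroCons _) 0 0 = _ at h
    rw [← corankUnit_mul_mul_corankUnit, map_mul, map_mul, hΨ, hΨ] at h
    rw [← map_mul, adjugate_fin_succ_eq_det_submatrix, ← mul_assoc, ← pow_add]
    rw [Even.neg_one_pow ⟨_, rfl⟩, one_mul, ← h]
    simp
  have h0 : ψ 0 = 0 := by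
    have h := hent 0 0 0
    have : Nontrivial (Fin (m + 1)) := Fin.nontrivial_iff_two_le.mpr (by omega)
    rw [hzero, adjugate_zero] at h
    simpa using h.symm
  -- The factor ψ((-1)^(i+j)) splits as s i * s j, so conjugating by `diagonal s` removes the
  -- cofactor signs.
  let s : Fin (m + 1) → F := fun i => ψ ((-1) ^ (i : ℕ))
  have hs : ∀ i, s i * s i = 1 := fun i => by
    simp only [s]
    rw [← map_mul, ← pow_add, Even.neg_one_pow ⟨_, rfl⟩, map_one]
  have hss : diagonal s * diagonal s = 1 := by
    rw [diagonal_mul_diagonal]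
    simp [hs]
  let Q : GL (Fin (m + 1)) F := ⟨diagonal s, diagonal s, hss, hss⟩
  have hent' : ∀ A i j, conjMap Ψ Q A i j = ψ (A.adjugateᵀ i j) := by
    intro A i j
    change (diagonal s * Ψ A * diagonal s) i j = _
    rw [mul_diagonal, diagonal_mul, hent, pow_add, map_mul, transpose_apply]
    linear_combination (ψ (A.adjugate j i) * s j * s j) * hs i + ψ (A.adjugate j i) * hs j
  let Θ : Matrix (Fin (m + 1)) (Fin (m + 1)) F →ₙ* Matrix (Fin (m + 1)) (Fin (m + 1)) F :=
    { toFun := fun A => A.adjugateᵀ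
      map_mul' := fun A B => by rw [adjugate_mul_distrib, transpose_mul] }
  have h01 : (0 : Fin (m + 1)) ≠ Fin.last m := by
    rw [Ne, Fin.ext_iff]
    simp
    omega
  -- The adjugate of a transvection is its inverse; transposing it swaps the two indices.
  have hadd := Matrix.map_add_of_entrywise (conjMap Ψ Q) Θ ψ h0 (map_one ψ) hent' h01 (fun c => by
    refine ⟨transvection (Fin.last m) 0 (-c), ?_⟩
    have hdet := det_transvection_of_ne _ _ h01.symm (-c)
    have hinv : transvection (Fin.last m) 0 (-c) * transvection (Fin.last m) 0 c = 1 := by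
      rw [transvection_mul_transvection_same _ _ h01.symm, neg_add_cancel, transvection_zero]
    have hadj : (transvection (Fin.last m) 0 (-c)).adjugate = transvection (Fin.last m) 0 c := by
      rw [← inv_eq_right_inv hinv, inv_def, hdet]
      simp
    change (transvection (Fin.last m) 0 (-c)).adjugateᵀ = _
    rw [hadj]
    simp [transvection])
  let φ : F →+* F :=
    { toFun := ψ, map_one' := map_one ψ, map_mul' := map_mul ψ, map_zero' := h0, map_add' := hadd }
  refine ⟨φ, Q, fun A => ?_⟩
  ext i j
  rw [hent']
  change φ _ = _
  rw [← RingHom.mapMatrix_apply, ← RingHom.map_adjugate]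
  rfl

end MultiplicativeMatrixMaps

theorem mainTheorem2 {F : Type*} [Field F] [CharZero F] (n : ℕ)
    (Φ : Matrix (Fin n) (Fin n) F →ₙ* Matrix (Fin n) (Fin n) F)
    (hzero : Φ 0 = 0) (hnd : IsNondegenerateMap Φ) :
    ∃ (φ : F →+* F) (R : Matrix.GeneralLinearGroup (Fin n) F),
      (∀ A : Matrix (Fin n) (Fin n) F,
        Φ A = (↑(R⁻¹) : Matrix (Fin n) (Fin n) F) * A.map φ * (R : Matrix (Fin n) (Fin n) F)) ∨
      (∀ A : Matrix (Fin n) (Fin n) F,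
        Φ A = (↑(R⁻¹) : Matrix (Fin n) (Fin n) F) * ((A.map φ).adjugate).transpose *
          (R : Matrix (Fin n) (Fin n) F)) := by
  obtain ⟨A, hA, hΦA⟩ := hnd
  obtain _ | m := n
  · simp at hA
  obtain ⟨r, hr1, hrm, hr, hcard, hlt⟩ := Matrix.map_diagIdem_dichotomy Φ hzero hA hΦA
  have hconj : ∀ (Q : GL (Fin (m + 1)) F) A,
      Φ A = (↑(Q⁻¹)⁻¹ : Matrix (Fin (m + 1)) (Fin (m + 1)) F) * Matrix.conjMap Φ Q A *
        (↑Q⁻¹ : Matrix (Fin (m + 1)) (Fin (m + 1)) F) := by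
    intro Q A
    simp [Matrix.conjMap, mul_assoc]
  have hzero' : ∀ Q, Matrix.conjMap Φ Q 0 = 0 := fun Q => by simp [Matrix.conjMap, hzero]
  rcases hr with rfl | rfl
  · obtain ⟨Q, hQ⟩ := Matrix.exists_conj_matrixUnits (fun i j => Φ (Matrix.single i j 1))
      (fun i j k => by rw [← map_mul, Matrix.single_mul_single_same, mul_one])
      (fun i j k l h => by rw [← map_mul, Matrix.single_mul_single_of_ne _ _ _ _ h, hzero]) 0
      (by
        have h := hcard {0} (by simp)
        convert h
        ext i j
        simp [Matrix.diagIdem, Matrix.diagonal_apply, Matrix.single_apply]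
        grind)
    have : Nontrivial (Fin (m + 1)) := Fin.nontrivial_iff_two_le.mpr (by omega)
    obtain ⟨φ, hφ⟩ := Matrix.exists_ringHom_of_map_single (Matrix.conjMap Φ Q) (hzero' Q) hQ
    exact ⟨φ, Q⁻¹, Or.inl fun A => by rw [← hφ]; exact hconj Q A⟩
  · obtain ⟨Q, hQ⟩ := Matrix.exists_conj_matrixUnits (fun i j => Φ (Matrix.corankUnit F i j))
      (fun i j k => by rw [← map_mul, Matrix.corankUnit_mul])
      -- For j ≠ k the inner product is an idempotent of rank m - 1, below the least surviving rank.
      (fun i j k l h => by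
        rw [← Matrix.corankUnit_mul i j j, ← Matrix.corankUnit_mul k k l, map_mul, map_mul,
          mul_assoc, ← mul_assoc (Φ (Matrix.corankUnit F j j)), ← map_mul,
          Matrix.corankUnit_self, Matrix.corankUnit_self, Matrix.diagIdem_mul, hlt, zero_mul,
          mul_zero]
        rw [← Finset.compl_union, Finset.card_compl, Finset.union_comm]
        simp only [Fintype.card_fin, Finset.singleton_union]
        rw [Finset.card_pair (Ne.symm h)]
        omega) 0
      (by
        rw [Matrix.corankUnit_self]
        exact hcard _ (by simp [Finset.card_compl]))
    obtain ⟨φ, T, hφ⟩ := Matrix.exists_ringHom_of_map_corankUnit hr1 (Matrix.conjMap Φ Q)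
      (hzero' Q) hQ
    refine ⟨φ, (Q * T)⁻¹, Or.inr fun A => ?_⟩
    rw [← hφ]
    convert hconj (Q * T) A using 3
    simp [Matrix.conjMap, mul_assoc]
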